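/- Let $A\in\mathbb{R}^{m\times d_1}$ and $B\in\mathbb{R}^{m\times d_2}$ be nonzero matrices with rows $a_1^T,\dots,a_m^T$ and $b_1^T,\dots,b_m^T$. Write $\|\cdot\|$ for the spectral norm of a matrix, $\|\cdot\|_F$ for the Frobenius norm, $\hat a_t=a_t/\|A\|$ and $\hat b_t=b_t/\|B\|$ for the rescaled rows, and $\rho_A=\|A\|_F^2/\|A\|^2$, $\rho_B=\|B\|_F^2/\|B\|^2$ for the stable ranks. Let $\epsilon\in(0,1)$, $\beta\in(0,1]$, $\delta>0$, and let $p_1,\dots,p_m\ge 0$ with $\sum_{t=1}^m p_t=1$ satisfy, for every $t$, $$p_t\ \ge\ \beta\,\frac{\hat a_t^T\hat a_t+\hat b_t^T\hat b_t}{\sum_{s=1}^m\left(\hat a_s^T\hat a_s+\hat b_s^T\hat b_s\right)}.$$ Let $t_1,\dots,t_r$ be independent random indices in $\{1,\dots,m\}$, each equal to $t$ with probability $p_t$, let $Q\in\mathbb{R}^{r\times m}$ be the random row-sampling matrix whose $j$-th row is $e_{t_j}^T/\sqrt{r\,p_{t_j}}$ (where $e_1,\dots,e_m$ is the standard basis of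 $\mathbb{R}^m$), and put $\tilde A=QA$, $\tilde B=QB$. If $$r\ \ge\ \frac{8(\rho_A+\rho_B)}{\beta\epsilon^2}\,\ln\frac{2(d_1+d_2)}{\delta},$$ then $\sum_{s=1}^m(\hat a_s^T\hat a_s+\hat b_s^T\hat b_s)=\rho_A+\rho_B$ (so the condition on the probabilities reads $p_t\ge\beta(\hat a_t^T\hat a_t+\hat b_t^T\hat b_t)/(\rho_A+\rho_B)$), and with probability at least $1-\delta$, $$\|A^TB-\tilde A^T\tilde B\|\ \le\ \epsilon\,\|A\|\,\|B\|.$$ -/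

import Mathlib

open MeasureTheory ProbabilityTheory
-- `‖M‖` of a real matrix is its spectral norm (operator norm for the Euclidean norms).
open scoped Matrix Matrix.Norms.L2Operator

noncomputable section

namespace RowSampling

/-- The stable ("soft") rank `‖A‖_F² / ‖A‖²`, with the Frobenius norm written out. -/
def stableRank {m d : ℕ} (A : Matrix (Fin m) (Fin d) ℝ) : ℝ :=
  (∑ t, ∑ j, A t j ^ 2) / ‖A‖ ^ 2

/-- The `t`-th row of `A`, divided by the spectral norm of `A`. -/
def rescaledRow {m d : ℕ} (A : Matrix (Fin m) (Fin d) ℝ) (t : Fin m) : Fin d → ℝ :=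
  ‖A‖⁻¹ • A.row t

/-- The sum of the squared Euclidean norms of the `t`-th rescaled rows of `A` and `B`. -/
def rowWeight {m d₁ d₂ : ℕ} (A : Matrix (Fin m) (Fin d₁) ℝ) (B : Matrix (Fin m) (Fin d₂) ℝ)
    (t : Fin m) : ℝ :=
  rescaledRow A t ⬝ᵥ rescaledRow A t + rescaledRow B t ⬝ᵥ rescaledRow B t

/-- The `r × m` row-sampling matrix for probabilities `p` and sampled indices `t`: its `j`-th row
is `e_{t j} / √(r p_{t j})`. -/
def samplingMatrix {r m : ℕ} (p : Fin m → ℝ) (t : Fin r → Fin m) : Matrix (Fin r) (Fin m) ℝ :=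
  Matrix.of fun j => (1 / √((r : ℝ) * p (t j))) • (Pi.single (t j) 1 : Fin m → ℝ)

/-- `T 0, …, T (r - 1)` are independent random indices, each equal to `t` with probability
`p t`. -/
structure IsIIDSample {Ω : Type*} [MeasurableSpace Ω] (μ : Measure Ω) {r m : ℕ}
    (p : Fin m → ℝ) (T : Fin r → Ω → Fin m) : Prop where
  measurable : ∀ j, Measurable (T j)
  indep : iIndepFun T μ
  prob : ∀ j t, μ.real {ω | T j ω = t} = p t

end RowSampling

end

namespace RowSampling

/-! ### The Golden–Thompson inequality for real symmetric matrices. -/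

section GoldenThompson

variable {n : Type*} [Fintype n] [DecidableEq n]

/-! After dividing `A` and `B` by their spectral norms, the sampled product is an average of `r`
independent copies of `a_t b_tᵀ / p_t`, whose mean is `Aᵀ * B`. Passing to the symmetric `dilation`
makes this a matrix Bernstein problem. With `V = ρ / β`, the probability condition bounds each
summand's norm by `V / 2` (AM–GM) and the second moment by `V • 1`.

The tail bound follows Ahlswede–Winter: `trace_exp_add_le` peels off one sample at a time from the
trace of the exponential, `exp X ≤ 1 + X + X ^ 2` bounds each factor, and Markov's inequality gives
`sum_prod_norm_gt_le`. All of this is about finite weighted sums over index tuples;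
`IsIIDSample.measureReal_mem` identifies these sums with probabilities. -/

lemma trace_pow_mul_comm (U V : Matrix n n ℝ) (k : ℕ) :
    ((U * V) ^ k).trace = ((V * U) ^ k).trace := by
  cases k with
  | zero => simp
  | succ k =>
    have h : ∀ j : ℕ, (U * V) ^ j * U = U * (V * U) ^ j := fun j => by
      induction j with
      | zero => simp
      | succ j ih => rw [pow_succ, mul_assoc, mul_assoc U V U, ← mul_assoc, ih, pow_succ, mul_assoc]
    rw [pow_succ, ← mul_assoc, h, Matrix.trace_mul_comm, ← mul_assoc, ← pow_succ']

lemma trace_mul_transpose_self_nonneg {n : Type*} [Fintype n] (X : Matrix n n ℝ) : 0 ≤ (X * Xᵀ).trace := by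
  simp only [Matrix.trace, Matrix.diag, Matrix.mul_apply, Matrix.transpose_apply]
  exact Finset.sum_nonneg fun i _ => Finset.sum_nonneg fun j _ => mul_self_nonneg _

/-- A form of the Cauchy–Schwarz inequality for the Frobenius inner product. -/
lemma two_mul_trace_mul_le {n : Type*} [Fintype n] (X Y : Matrix n n ℝ) :
    2 * (X * Y).trace ≤ (X * Xᵀ).trace + (Y * Yᵀ).trace := by
  have h := trace_mul_transpose_self_nonneg (X - Yᵀ)
  have h1 : ((Yᵀ : Matrix n n ℝ) * Xᵀ).trace = (X * Y).trace := by
    rw [← Matrix.transpose_mul, Matrix.trace_transpose]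
  simp only [Matrix.transpose_sub, Matrix.transpose_transpose, sub_mul, mul_sub,
    Matrix.trace_sub, h1, Matrix.trace_mul_comm Yᵀ Y] at h
  linarith

/-- The two claims feed each other. The first at `k + 1` follows from the second at `k` for `X * Xᵀ`
and `Xᵀ * X`, whose powers have equal traces, plus Cauchy–Schwarz. The second at `k + 1` follows
from the first at `k` for `X = A * B`, then the second at `k` for `A ^ 2` and `B ^ 2`. -/
lemma trace_pow_two_pow_le (k : ℕ) :
    (∀ X : Matrix n n ℝ, (X ^ (2 * 2 ^ k)).trace ≤ ((X * Xᵀ) ^ 2 ^ k).trace) ∧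
    (∀ A B : Matrix n n ℝ, A.IsSymm → B.IsSymm →
      ((A * B) ^ 2 ^ k).trace ≤ (A ^ 2 ^ k * B ^ 2 ^ k).trace) := by
  induction k with
  | zero =>
    refine ⟨fun X => ?_, fun A B _ _ => by simp⟩
    have := two_mul_trace_mul_le X X
    simp only [pow_zero, mul_one, pow_one, pow_two]
    linarith
  | succ k ih =>
    obtain ⟨hS, hG⟩ := ih
    refine ⟨fun X => ?_, fun A B hA hB => ?_⟩
    · have hP : (Xᵀ * X).IsSymm := by simp [Matrix.IsSymm]
      have hQ : (X * Xᵀ).IsSymm := by simp [Matrix.IsSymm]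
      calc (X ^ (2 * 2 ^ (k + 1))).trace = ((X ^ 2) ^ (2 * 2 ^ k)).trace := by
            rw [← pow_mul]; congr 2; ring
        _ ≤ ((X ^ 2 * (X ^ 2)ᵀ) ^ 2 ^ k).trace := hS _
        _ = ((X * (X * Xᵀ * Xᵀ)) ^ 2 ^ k).trace := by
            congr 2; simp only [pow_two, Matrix.transpose_mul, mul_assoc]
        _ = ((X * Xᵀ * (Xᵀ * X)) ^ 2 ^ k).trace := by
            rw [trace_pow_mul_comm]; simp only [mul_assoc]
        _ ≤ ((X * Xᵀ) ^ 2 ^ k * (Xᵀ * X) ^ 2 ^ k).trace := hG _ _ hQ hP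
        _ ≤ ((X * Xᵀ) ^ 2 ^ (k + 1)).trace := by
            have h := two_mul_trace_mul_le ((X * Xᵀ) ^ 2 ^ k) ((Xᵀ * X) ^ 2 ^ k)
            rw [(hQ.pow _).eq, (hP.pow _).eq, ← pow_add, ← pow_add,
              trace_pow_mul_comm Xᵀ X, ← two_mul, ← two_mul, ← pow_succ'] at h
            linarith
    · have hA2 : (A ^ 2).IsSymm := hA.pow 2
      have hB2 : (B ^ 2).IsSymm := hB.pow 2
      calc ((A * B) ^ 2 ^ (k + 1)).trace = ((A * B) ^ (2 * 2 ^ k)).trace := by rw [pow_succ']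
        _ ≤ ((A * B * (A * B)ᵀ) ^ 2 ^ k).trace := hS _
        _ = ((A * (B ^ 2 * A)) ^ 2 ^ k).trace := by
            rw [Matrix.transpose_mul, hA.eq, hB.eq]; congr 2; simp only [pow_two, mul_assoc]
        _ = ((B ^ 2 * A ^ 2) ^ 2 ^ k).trace := by
            rw [trace_pow_mul_comm]; simp only [pow_two, mul_assoc]
        _ = ((A ^ 2 * B ^ 2) ^ 2 ^ k).trace := trace_pow_mul_comm _ _ _
        _ ≤ ((A ^ 2) ^ 2 ^ k * (B ^ 2) ^ 2 ^ k).trace := hG _ _ hA2 hB2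
        _ = (A ^ 2 ^ (k + 1) * B ^ 2 ^ (k + 1)).trace := by
            rw [← pow_mul, ← pow_mul, ← pow_succ']

lemma norm_pow_sub_pow_le {R : Type*} [NormedRing R] [NormOneClass R] {X Y : R} {M : ℝ}
    (hM : 1 ≤ M) (hX : ‖X‖ ≤ M) (hY : ‖Y‖ ≤ M) (k : ℕ) :
    ‖X ^ k - Y ^ k‖ ≤ k * ‖X - Y‖ * M ^ k := by
  induction k with
  | zero => simp
  | succ k ih =>
    have h : X ^ (k + 1) - Y ^ (k + 1) = X ^ k * (X - Y) + (X ^ k - Y ^ k) * Y := by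
      rw [pow_succ, pow_succ]; noncomm_ring
    have hXk : ‖X ^ k‖ ≤ M ^ k :=
      (norm_pow_le X k).trans (pow_le_pow_left₀ (norm_nonneg _) hX k)
    have hM0 : (0 : ℝ) ≤ M ^ k := by positivity
    calc ‖X ^ (k + 1) - Y ^ (k + 1)‖ ≤ ‖X ^ k‖ * ‖X - Y‖ + ‖X ^ k - Y ^ k‖ * ‖Y‖ := by
          rw [h]; exact (norm_add_le _ _).trans (add_le_add (norm_mul_le _ _) (norm_mul_le _ _))
      _ ≤ M ^ k * ‖X - Y‖ + (k * ‖X - Y‖ * M ^ k) * M := by gcongr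
      _ ≤ (M ^ k * M) * ‖X - Y‖ + (k * ‖X - Y‖ * M ^ k) * M := by
          gcongr; exact le_mul_of_one_le_right hM0 hM
      _ = _ := by push_cast; ring

open NormedSpace in
lemma norm_exp_le_exp_norm {R : Type*} [NormedRing R] [NormOneClass R] [NormedAlgebra ℝ R]
    [CompleteSpace R] (x : R) : ‖exp x‖ ≤ Real.exp ‖x‖ := by
  have hsum := expSeries_summable' (𝕂 := ℝ) ‖x‖
  rw [Real.exp_eq_exp_ℝ, congrFun (exp_eq_tsum ℝ (𝔸 := R)) x, congrFun (exp_eq_tsum ℝ (𝔸 := ℝ)) ‖x‖]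
  refine tsum_of_norm_bounded hsum.hasSum fun k => ?_
  rw [norm_smul, norm_inv, Real.norm_natCast, smul_eq_mul]
  gcongr
  exact norm_pow_le x k

open NormedSpace Filter Topology in
/-- The **Lie–Trotter product formula**. -/
lemma tendsto_exp_mul_exp_pow {R : Type*} [NormedRing R] [NormOneClass R] [NormedAlgebra ℝ R]
    [CompleteSpace R] (A B : R) :
    Tendsto (fun k : ℕ => (exp ((k : ℝ)⁻¹ • A) * exp ((k : ℝ)⁻¹ • B)) ^ k) atTop
      (𝓝 (exp (A + B))) := by
  let : NormedAlgebra ℚ R := NormedAlgebra.restrictScalars ℚ ℝ R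
  -- `D` vanishes to first order at `0`, so `‖D (1 / k)‖ = o(1 / k)`; this beats the factor `k` lost
  -- when comparing `k`-th powers.
  set D : ℝ → R := fun s => exp (s • A) * exp (s • B) - exp (s • (A + B)) with hD
  have hD0 : D 0 = 0 := by simp [hD]
  have hder : HasDerivAt D 0 0 := by
    have h := ((hasDerivAt_exp_smul_const (𝕂 := ℝ) A (0 : ℝ)).mul
      (hasDerivAt_exp_smul_const (𝕂 := ℝ) B (0 : ℝ))).sub
      (hasDerivAt_exp_smul_const (𝕂 := ℝ) (A + B) (0 : ℝ))
    rw [zero_smul, zero_smul, zero_smul] at h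
    simp only [NormedSpace.exp_zero, one_mul, mul_one, sub_self] at h
    exact h
  have hlim : Tendsto (fun k : ℕ => (k : ℝ) * ‖D ((k : ℝ)⁻¹)‖) atTop (𝓝 0) := by
    have h1 := hder.tendsto_slope_zero
    have h2 : Tendsto (fun k : ℕ => ((k : ℝ))⁻¹) atTop (𝓝[≠] 0) := by
      refine tendsto_nhdsWithin_iff.2 ⟨tendsto_inv_atTop_nhds_zero_nat, ?_⟩
      filter_upwards [eventually_gt_atTop 0] with k hk
      simp [hk.ne']
    have h3 := (h1.comp h2).norm
    simpa [Function.comp_def, hD0, norm_smul] using h3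
  set c := ‖A‖ + ‖B‖ with hc
  have hexp : ∀ x : R, ‖exp x‖ ≤ Real.exp ‖x‖ := norm_exp_le_exp_norm
  have hbound : ∀ᶠ k : ℕ in atTop,
      ‖(exp ((k : ℝ)⁻¹ • A) * exp ((k : ℝ)⁻¹ • B)) ^ k - exp (A + B)‖
        ≤ ((k : ℝ) * ‖D ((k : ℝ)⁻¹)‖) * Real.exp c := by
    filter_upwards [eventually_gt_atTop 0] with k hk
    have hk0 : (k : ℝ) ≠ 0 := by positivity
    have hE : exp (A + B) = exp ((k : ℝ)⁻¹ • (A + B)) ^ k := by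
      rw [← exp_nsmul, ← Nat.cast_smul_eq_nsmul ℝ, smul_smul, mul_inv_cancel₀ hk0, one_smul]
    have hX : ‖exp ((k : ℝ)⁻¹ • A) * exp ((k : ℝ)⁻¹ • B)‖ ≤ Real.exp ((k : ℝ)⁻¹ * c) := by
      refine (norm_mul_le _ _).trans ?_
      rw [hc, mul_add, Real.exp_add]
      gcongr
      · simpa [norm_smul] using hexp ((k : ℝ)⁻¹ • A)
      · simpa [norm_smul] using hexp ((k : ℝ)⁻¹ • B)
    have hY : ‖exp ((k : ℝ)⁻¹ • (A + B))‖ ≤ Real.exp ((k : ℝ)⁻¹ * c) := by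
      refine (hexp _).trans (Real.exp_le_exp.2 ?_)
      rw [norm_smul, norm_inv, Real.norm_natCast]
      gcongr
      exact norm_add_le _ _
    have hM : 1 ≤ Real.exp ((k : ℝ)⁻¹ * c) := Real.one_le_exp (by positivity)
    have h := norm_pow_sub_pow_le hM hX hY k
    rwa [← Real.exp_nat_mul, mul_inv_cancel_left₀ hk0, ← hE] at h
  rw [tendsto_iff_norm_sub_tendsto_zero]
  refine squeeze_zero' (Eventually.of_forall fun _ => norm_nonneg _) hbound ?_
  simpa using hlim.mul_const (Real.exp c)

open NormedSpace Filter Topology in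
/-- The **Golden–Thompson inequality**. -/
theorem trace_exp_add_le {A B : Matrix n n ℝ} (hA : A.IsSymm) (hB : B.IsSymm) :
    (exp (A + B)).trace ≤ (exp A * exp B).trace := by
  cases isEmpty_or_nonempty n with
  | inl h => simp [Matrix.trace]
  | inr h =>
    have : NormOneClass (Matrix n n ℝ) := inferInstance
    -- The trace inequality is known only for exponents `2 ^ k`, so the Lie–Trotter limit is taken
    -- along that subsequence.
    have hpow : Tendsto (fun k : ℕ => 2 ^ k) atTop atTop :=
      tendsto_pow_atTop_atTop_of_one_lt one_lt_two
    have hcont : Continuous fun M : Matrix n n ℝ => M.trace := by fun_prop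
    have hlim := (hcont.tendsto _).comp ((tendsto_exp_mul_exp_pow A B).comp hpow)
    refine le_of_tendsto hlim (Eventually.of_forall fun k => ?_)
    have hk0 : ((2 ^ k : ℕ) : ℝ) ≠ 0 := by positivity
    have hE : ∀ M : Matrix n n ℝ, exp (((2 ^ k : ℕ) : ℝ)⁻¹ • M) ^ 2 ^ k = exp M := fun M => by
      rw [← Matrix.exp_nsmul, ← Nat.cast_smul_eq_nsmul ℝ, smul_smul, mul_inv_cancel₀ hk0,
        one_smul]
    have h := (trace_pow_two_pow_le k).2 (exp (((2 ^ k : ℕ) : ℝ)⁻¹ • A))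
      (exp (((2 ^ k : ℕ) : ℝ)⁻¹ • B)) (hA.smul _).exp (hB.smul _).exp
    rwa [hE, hE] at h

end GoldenThompson

end RowSampling

namespace RowSampling

/-! ### Matrix Bernstein inequality by the trace exponential method. -/

section MatrixConcentration

variable {n : Type*} [Fintype n] [DecidableEq n]

lemma exists_unitary_diagonalization {X : Matrix n n ℝ} (hX : X.IsSymm) :
    ∃ (U : unitary (Matrix n n ℝ)) (l : n → ℝ),
      X = (U : Matrix n n ℝ) * Matrix.diagonal l * star (U : Matrix n n ℝ) := by
  have hH : X.IsHermitian := by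
    rw [Matrix.IsHermitian, Matrix.conjTranspose_eq_transpose_of_trivial, hX.eq]
  refine ⟨hH.eigenvectorUnitary, hH.eigenvalues, ?_⟩
  have h := hH.spectral_theorem
  rw [Unitary.conjStarAlgAut_apply] at h
  simpa [Function.comp_def] using h

lemma norm_unitary_conj (U : unitary (Matrix n n ℝ)) (l : n → ℝ) :
    ‖(U : Matrix n n ℝ) * Matrix.diagonal l * star (U : Matrix n n ℝ)‖ = ‖l‖ := by
  rw [← Unitary.coe_star, CStarRing.norm_mul_coe_unitary, CStarRing.norm_coe_unitary_mul,
    Matrix.l2_opNorm_diagonal]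

open NormedSpace in
lemma exp_unitary_conj (U : unitary (Matrix n n ℝ)) (l : n → ℝ) :
    exp ((U : Matrix n n ℝ) * Matrix.diagonal l * star (U : Matrix n n ℝ)) =
      (U : Matrix n n ℝ) * Matrix.diagonal (fun i => Real.exp (l i)) * star (U : Matrix n n ℝ) := by
  have h := Matrix.exp_units_conj (Unitary.toUnits U) (Matrix.diagonal l)
  rw [Matrix.exp_diagonal] at h
  have hl : exp l = fun i => Real.exp (l i) := by
    ext i
    rw [Pi.coe_exp, Real.exp_eq_exp_ℝ]
  rw [hl] at h
  exact h

lemma trace_unitary_conj (U : unitary (Matrix n n ℝ)) (M : Matrix n n ℝ) :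
    ((U : Matrix n n ℝ) * M * star (U : Matrix n n ℝ)).trace = M.trace := by
  rw [Matrix.trace_mul_comm, ← mul_assoc, Unitary.coe_star_mul_self, one_mul]

open NormedSpace in
-- The norm is some `|l i|`, so its exponential is an eigenvalue of `exp X` or `exp (-X)`, and all
-- other eigenvalues are positive.
lemma exp_norm_le_trace_add_trace [Nonempty n] {X : Matrix n n ℝ} (hX : X.IsSymm) :
    Real.exp ‖X‖ ≤ (exp X).trace + (exp (-X)).trace := by
  obtain ⟨U, l, rfl⟩ := exists_unitary_diagonalization hX
  have hneg : -((U : Matrix n n ℝ) * Matrix.diagonal l * star (U : Matrix n n ℝ)) =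
      (U : Matrix n n ℝ) * Matrix.diagonal (-l) * star (U : Matrix n n ℝ) := by
    have : Matrix.diagonal (-l) = -Matrix.diagonal l := (Matrix.diagonal_neg l).symm
    rw [this, mul_neg, neg_mul]
  rw [hneg, exp_unitary_conj, exp_unitary_conj, trace_unitary_conj, trace_unitary_conj,
    norm_unitary_conj, Matrix.trace_diagonal, Matrix.trace_diagonal, ← Finset.sum_add_distrib]
  have hle : ∀ i, Real.exp ‖l i‖ ≤ ∑ j, (Real.exp (l j) + Real.exp ((-l) j)) := fun i => by
    refine le_trans ?_ (Finset.single_le_sum (f := fun j => Real.exp (l j) + Real.exp ((-l) j))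
      (fun j _ => by positivity) (Finset.mem_univ i))
    rw [Real.norm_eq_abs, Pi.neg_apply]
    rcases abs_cases (l i) with h | h <;> rw [h.1] <;>
      linarith [Real.exp_pos (l i), Real.exp_pos (-(l i))]
  have hpos : 0 < ∑ j, (Real.exp (l j) + Real.exp ((-l) j)) :=
    (Real.exp_pos _).trans_le (hle (Classical.arbitrary n))
  rw [← Real.le_log_iff_exp_le hpos, pi_norm_le_iff_of_nonempty]
  exact fun i => (Real.le_log_iff_exp_le hpos).2 (hle i)

open NormedSpace in
-- Diagonalizing reduces this to `e ^ x ≤ 1 + x + x ^ 2` for `|x| ≤ 1`.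
lemma posSemidef_one_add_add_sq_sub_exp {X : Matrix n n ℝ} (hX : X.IsSymm) (h1 : ‖X‖ ≤ 1) :
    (1 + X + X ^ 2 - exp X).PosSemidef := by
  obtain ⟨U, l, rfl⟩ := exists_unitary_diagonalization hX
  rw [norm_unitary_conj] at h1
  rw [exp_unitary_conj]
  set V : Matrix n n ℝ := (U : Matrix n n ℝ) with hV
  have hVV : star V * V = 1 := Unitary.coe_star_mul_self U
  have hVV' : V * star V = 1 := Unitary.coe_mul_star_self U
  have hsq : (V * Matrix.diagonal l * star V) ^ 2 =
      V * (Matrix.diagonal l * Matrix.diagonal l) * star V := by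
    rw [pow_two]
    calc _ = V * Matrix.diagonal l * (star V * V) * Matrix.diagonal l * star V := by
          simp only [mul_assoc]
      _ = _ := by rw [hVV]; simp only [mul_one, mul_assoc]
  have h : 1 + V * Matrix.diagonal l * star V + (V * Matrix.diagonal l * star V) ^ 2
      - V * Matrix.diagonal (fun i => Real.exp (l i)) * star V
      = V * Matrix.diagonal (fun i => 1 + l i + l i * l i - Real.exp (l i)) * star V := by
    rw [hsq, ← Matrix.diagonal_sub, ← Matrix.diagonal_add, ← Matrix.diagonal_add,
      ← Matrix.diagonal_mul_diagonal, Matrix.diagonal_one]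
    simp only [mul_add, add_mul, mul_sub, sub_mul, mul_one, hVV']
  rw [h]
  refine Matrix.PosSemidef.mul_mul_conjTranspose_same (Matrix.PosSemidef.diagonal fun i => ?_) V
  have hli : |l i| ≤ 1 := (norm_le_pi_norm l i).trans h1
  have := (abs_le.1 (Real.abs_exp_sub_one_sub_id_le hli)).2
  simp only [Pi.zero_apply]
  linarith [pow_two (l i)]

open NormedSpace in
lemma trace_exp_mul_nonneg {R Z : Matrix n n ℝ} (hR : R.IsSymm) (hZ : Z.PosSemidef) :
    0 ≤ (exp R * Z).trace := by
  set E := exp ((2 : ℝ)⁻¹ • R) with hE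
  have hE2 : exp R = E * E := by
    rw [hE, ← Matrix.exp_add_of_commute _ _ (Commute.refl _), ← add_smul]
    norm_num
  have hEs : Eᴴ = E := by
    rw [Matrix.conjTranspose_eq_transpose_of_trivial]
    exact (hR.smul _).exp.eq
  have h := (hZ.conjTranspose_mul_mul_same E).trace_nonneg
  rwa [hEs, Matrix.trace_mul_comm, ← mul_assoc, ← hE2] at h

open NormedSpace in
/-- The moment generating function bound for a sum of `r` independent copies of a random symmetric
matrix with finitely many values `X i`, attained with weights `p i`. -/
lemma sum_prod_mul_trace_exp_le {ι : Type*} [Fintype ι] {p : ι → ℝ} (hp : ∀ i, 0 ≤ p i)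
    {X : ι → Matrix n n ℝ} (hX : ∀ i, (X i).IsSymm) {c : ℝ} (hc : 0 ≤ c)
    (h : (c • (1 : Matrix n n ℝ) - ∑ i, p i • exp (X i)).PosSemidef) (r : ℕ)
    {K : Matrix n n ℝ} (hK : K.IsSymm) :
    ∑ f : Fin r → ι, (∏ j, p (f j)) * (exp (K + ∑ j, X (f j))).trace
      ≤ (exp K).trace * c ^ r := by
  induction r generalizing K with
  | zero => simp
  | succ r ih =>
    -- Golden–Thompson separates one sample from `K`; pairing with the positive matrix `exp K` then
    -- preserves the semidefinite bound `h`.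
    have hstep : ∑ i, p i * (exp (K + X i)).trace ≤ (exp K).trace * c := by
      have h1 := trace_exp_mul_nonneg hK h
      rw [mul_sub, Matrix.trace_sub, mul_smul_comm, mul_one, Matrix.trace_smul, Finset.mul_sum,
        Matrix.trace_sum, smul_eq_mul, sub_nonneg] at h1
      rw [mul_comm _ c]
      refine le_trans (Finset.sum_le_sum fun i _ => ?_) h1
      rw [mul_smul_comm, Matrix.trace_smul, smul_eq_mul]
      exact mul_le_mul_of_nonneg_left (trace_exp_add_le hK (hX i)) (hp i)
    rw [← (Fin.consEquiv fun _ : Fin (r + 1) => ι).sum_comp, Fintype.sum_prod_type]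
    calc _ = ∑ i, p i * ∑ f : Fin r → ι,
          (∏ j, p (f j)) * (exp (K + X i + ∑ j, X (f j))).trace := by
          refine Finset.sum_congr rfl fun i _ => ?_
          rw [Finset.mul_sum]
          refine Finset.sum_congr rfl fun f _ => ?_
          simp only [Fin.consEquiv, Equiv.coe_fn_mk, Fin.prod_univ_succ, Fin.sum_univ_succ,
            Fin.cons_zero, Fin.cons_succ, add_assoc, mul_assoc]
      _ ≤ ∑ i, p i * ((exp (K + X i)).trace * c ^ r) :=
          Finset.sum_le_sum fun i _ => mul_le_mul_of_nonneg_left (ih (hK.add (hX i))) (hp i)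
      _ = (∑ i, p i * (exp (K + X i)).trace) * c ^ r := by
          rw [Finset.sum_mul]; simp only [mul_assoc]
      _ ≤ (exp K).trace * c * c ^ r := by gcongr
      _ = _ := by rw [pow_succ]; ring

open NormedSpace in
-- The mean of `exp X` is at most `1 + 0 + v ≤ e ^ v`; starting from `K = 0` contributes the trace
-- of the identity.
lemma sum_prod_mul_trace_exp_le_of_variance {ι : Type*} [Fintype ι] {p : ι → ℝ}
    (hp : ∀ i, 0 ≤ p i) (hp1 : ∑ i, p i = 1) {X : ι → Matrix n n ℝ} (hX : ∀ i, (X i).IsSymm)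
    (hX1 : ∀ i, ‖X i‖ ≤ 1) (hX0 : ∑ i, p i • X i = 0) {v : ℝ}
    (hv : (v • (1 : Matrix n n ℝ) - ∑ i, p i • X i ^ 2).PosSemidef) (r : ℕ) :
    ∑ f : Fin r → ι, (∏ j, p (f j)) * (exp (∑ j, X (f j))).trace
      ≤ Fintype.card n * Real.exp (r * v) := by
  have hc : (Real.exp v • (1 : Matrix n n ℝ) - ∑ i, p i • exp (X i)).PosSemidef := by
    have h1 : (∑ i, p i • (1 + X i + X i ^ 2 - exp (X i))).PosSemidef :=
      Matrix.posSemidef_sum _ fun i _ =>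
        (posSemidef_one_add_add_sq_sub_exp (hX i) (hX1 i)).smul (hp i)
    have h2 : ((Real.exp v - (1 + v)) • (1 : Matrix n n ℝ)).PosSemidef :=
      Matrix.PosSemidef.one.smul (by linarith [Real.add_one_le_exp v])
    have h3 := (h1.add hv).add h2
    convert h3 using 1
    simp only [smul_sub, smul_add, Finset.sum_sub_distrib, Finset.sum_add_distrib, hX0,
      ← Finset.sum_smul, hp1, sub_smul, add_smul, one_smul]
    abel
  have h := sum_prod_mul_trace_exp_le hp hX (Real.exp_pos v).le hc r
    (K := 0) (Matrix.isSymm_zero)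
  simpa [Real.exp_nat_mul] using h

open NormedSpace in
/-- A matrix Bernstein inequality for `r` independent samples from a finite set of symmetric
matrices. -/
lemma sum_prod_norm_gt_le [Nonempty n] {ι : Type*} [Fintype ι] {p : ι → ℝ}
    (hp : ∀ i, 0 ≤ p i) (hp1 : ∑ i, p i = 1) {X : ι → Matrix n n ℝ} (hX : ∀ i, (X i).IsSymm)
    (hX1 : ∀ i, ‖X i‖ ≤ 1) (hX0 : ∑ i, p i • X i = 0) {v : ℝ}
    (hv : (v • (1 : Matrix n n ℝ) - ∑ i, p i • X i ^ 2).PosSemidef) (r : ℕ) (s : ℝ)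
    (F : Finset (Fin r → ι)) (hF : ∀ f ∈ F, s ≤ ‖∑ j, X (f j)‖) :
    ∑ f ∈ F, ∏ j, p (f j) ≤ 2 * Fintype.card n * Real.exp (r * v - s) := by
  have hpos := sum_prod_mul_trace_exp_le_of_variance hp hp1 hX hX1 hX0 hv r
  have hneg := sum_prod_mul_trace_exp_le_of_variance hp hp1 (X := fun i => -X i)
    (fun i => (hX i).neg) (fun i => by rw [norm_neg]; exact hX1 i)
    (by simp [hX0]) (v := v) (by simpa using hv) r
  have hsymm : ∀ f : Fin r → ι, (∑ j, X (f j)).IsSymm := fun f => by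
    rw [Matrix.IsSymm, Matrix.transpose_sum]
    exact Finset.sum_congr rfl fun j _ => (hX (f j)).eq
  have hw : ∀ f : Fin r → ι, 0 ≤ ∏ j, p (f j) := fun f => Finset.prod_nonneg fun j _ => hp _
  have hT : ∀ f : Fin r → ι, Real.exp ‖∑ j, X (f j)‖ ≤
      (exp (∑ j, X (f j))).trace + (exp (-∑ j, X (f j))).trace :=
    fun f => exp_norm_le_trace_add_trace (hsymm f)
  simp only [Finset.sum_neg_distrib] at hneg
  -- Markov's inequality for the sum of the two trace exponentials.
  have key : (∑ f ∈ F, ∏ j, p (f j)) * Real.exp s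
      ≤ Fintype.card n * Real.exp (r * v) + Fintype.card n * Real.exp (r * v) := by
    refine le_trans ?_ (add_le_add hpos hneg)
    rw [Finset.sum_mul, ← Finset.sum_add_distrib]
    simp only [← mul_add]
    refine (Finset.sum_le_sum fun f hf => ?_).trans
      (Finset.sum_le_univ_sum_of_nonneg (s := F) fun f =>
        mul_nonneg (hw f) ((Real.exp_pos _).le.trans (hT f)))
    exact mul_le_mul_of_nonneg_left ((Real.exp_le_exp.2 (hF f hf)).trans (hT f)) (hw f)
  rw [Real.exp_sub, ← mul_div_assoc, le_div_iff₀ (Real.exp_pos s)]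
  linarith

end MatrixConcentration

end RowSampling

namespace RowSampling

/-! ### Symmetric dilation and the norm and variance of one sample. -/

section Dilation

variable {k l : Type*} [Fintype k] [Fintype l] [DecidableEq k] [DecidableEq l]

lemma norm_toLp_sq {l : Type*} [Fintype l] (x : l → ℝ) : ‖WithLp.toLp 2 x‖ ^ 2 = x ⬝ᵥ x := by
  rw [EuclideanSpace.real_norm_sq_eq]
  simp [dotProduct, pow_two]

lemma dotProduct_mulVec_self_le {k l : Type*} [Fintype k] [Fintype l] [DecidableEq l]
    (M : Matrix k l ℝ) (x : l → ℝ) : (M *ᵥ x) ⬝ᵥ (M *ᵥ x) ≤ ‖M‖ ^ 2 * (x ⬝ᵥ x) := by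
  have h := Matrix.l2_opNorm_mulVec M (WithLp.toLp 2 x)
  rw [← norm_toLp_sq, ← norm_toLp_sq, ← mul_pow]
  exact pow_le_pow_left₀ (norm_nonneg _) h 2

lemma norm_le_of_dotProduct_mulVec_self_le {k l : Type*} [Fintype k] [Fintype l] [DecidableEq l]
    {M : Matrix k l ℝ} {c : ℝ} (hc : 0 ≤ c)
    (h : ∀ x : l → ℝ, (M *ᵥ x) ⬝ᵥ (M *ᵥ x) ≤ c ^ 2 * (x ⬝ᵥ x)) : ‖M‖ ≤ c := by
  rw [Matrix.l2_opNorm_def]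
  refine ContinuousLinearMap.opNorm_le_bound _ hc fun x => ?_
  have hx := h x.ofLp
  rw [← norm_toLp_sq, ← norm_toLp_sq, ← mul_pow] at hx
  exact le_of_sq_le_sq hx (by positivity)

lemma sq_dotProduct_le {l : Type*} [Fintype l] (x y : l → ℝ) :
    (x ⬝ᵥ y) ^ 2 ≤ (x ⬝ᵥ x) * (y ⬝ᵥ y) := by
  have h := Finset.sum_mul_sq_le_sq_mul_sq Finset.univ x y
  simpa only [dotProduct, pow_two] using h

/-- The symmetric dilation of a rectangular matrix. -/
def dilation {k l : Type*} : Matrix k l ℝ →ₗ[ℝ] Matrix (k ⊕ l) (k ⊕ l) ℝ where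
  toFun M := Matrix.fromBlocks 0 M Mᵀ 0
  map_add' M N := by simp [Matrix.fromBlocks_add]
  map_smul' c M := by simp [Matrix.fromBlocks_smul]

lemma dilation_apply {k l : Type*} (M : Matrix k l ℝ) :
    dilation M = Matrix.fromBlocks 0 M Mᵀ 0 := rfl

lemma dilation_isSymm {k l : Type*} (M : Matrix k l ℝ) : (dilation M).IsSymm := by
  simp [Matrix.IsSymm, dilation_apply, Matrix.fromBlocks_transpose]

lemma dilation_mulVec_elim {k l : Type*} [Fintype k] [Fintype l] (M : Matrix k l ℝ)
    (u : k → ℝ) (v : l → ℝ) :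
    dilation M *ᵥ Sum.elim u v = Sum.elim (M *ᵥ v) (Mᵀ *ᵥ u) := by
  simp [dilation_apply, Matrix.fromBlocks_mulVec]

lemma dotProduct_elim_self {k l : Type*} [Fintype k] [Fintype l] (u : k → ℝ) (v : l → ℝ) :
    Sum.elim u v ⬝ᵥ Sum.elim u v = u ⬝ᵥ u + v ⬝ᵥ v := by
  simp [dotProduct]

lemma norm_le_norm_dilation (M : Matrix k l ℝ) : ‖M‖ ≤ ‖dilation M‖ := by
  refine norm_le_of_dotProduct_mulVec_self_le (norm_nonneg _) fun v => ?_
  have h := dotProduct_mulVec_self_le (dilation M) (Sum.elim 0 v)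
  rw [dilation_mulVec_elim, dotProduct_elim_self, dotProduct_elim_self] at h
  simpa using h

lemma dotProduct_dilation_vecMulVec_mulVec {k l : Type*} [Fintype k] [Fintype l]
    (a u : k → ℝ) (b v : l → ℝ) (c : ℝ) :
    (dilation (c • Matrix.vecMulVec a b) *ᵥ Sum.elim u v) ⬝ᵥ
      (dilation (c • Matrix.vecMulVec a b) *ᵥ Sum.elim u v) =
    c ^ 2 * ((b ⬝ᵥ v) ^ 2 * (a ⬝ᵥ a) + (a ⬝ᵥ u) ^ 2 * (b ⬝ᵥ b)) := by
  rw [dilation_mulVec_elim, dotProduct_elim_self]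
  simp only [Matrix.transpose_smul, Matrix.transpose_vecMulVec, Matrix.smul_mulVec,
    Matrix.vecMulVec_mulVec, smul_dotProduct, dotProduct_smul, smul_eq_mul,
    MulOpposite.smul_eq_mul_unop, MulOpposite.unop_op]
  ring

/-- The norm is governed by `|a| |b| / q`, and AM–GM gives `|a| |b| ≤ (|a|² + |b|²) / 2 ≤ V q / 2`.
For `q = 0` the matrix is zero since `0⁻¹ = 0`. -/
lemma norm_dilation_smul_vecMulVec_le (a : k → ℝ) (b : l → ℝ) {q V : ℝ} (hq : 0 ≤ q) (hV : 0 ≤ V)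
    (h : a ⬝ᵥ a + b ⬝ᵥ b ≤ V * q) : ‖dilation (q⁻¹ • Matrix.vecMulVec a b)‖ ≤ V / 2 := by
  refine norm_le_of_dotProduct_mulVec_self_le (by positivity) fun x => ?_
  obtain ⟨u, v, rfl⟩ : ∃ u v, x = Sum.elim u v := ⟨_, _, (Sum.elim_comp_inl_inr x).symm⟩
  rw [dotProduct_dilation_vecMulVec_mulVec, dotProduct_elim_self]
  have ha : 0 ≤ a ⬝ᵥ a := by simpa using dotProduct_star_self_nonneg a
  have hb : 0 ≤ b ⬝ᵥ b := by simpa using dotProduct_star_self_nonneg b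
  have hu : 0 ≤ u ⬝ᵥ u := by simpa using dotProduct_star_self_nonneg u
  have hv : 0 ≤ v ⬝ᵥ v := by simpa using dotProduct_star_self_nonneg v
  have h1 := mul_le_mul_of_nonneg_right (sq_dotProduct_le b v) ha
  have h2 := mul_le_mul_of_nonneg_right (sq_dotProduct_le a u) hb
  have h3 : (q⁻¹) ^ 2 * ((a ⬝ᵥ a) * (b ⬝ᵥ b)) ≤ (V / 2) ^ 2 := by
    rcases hq.eq_or_lt with rfl | hq
    · simp; positivity
    · rw [inv_pow, inv_mul_le_iff₀ (by positivity)]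
      nlinarith [sq_nonneg (a ⬝ᵥ a - b ⬝ᵥ b), pow_le_pow_left₀ (add_nonneg ha hb) h 2]
  calc _ ≤ q⁻¹ ^ 2 * ((b ⬝ᵥ b) * (v ⬝ᵥ v) * (a ⬝ᵥ a) + (a ⬝ᵥ a) * (u ⬝ᵥ u) * (b ⬝ᵥ b)) := by
        gcongr
    _ = (q⁻¹ ^ 2 * ((a ⬝ᵥ a) * (b ⬝ᵥ b))) * (u ⬝ᵥ u + v ⬝ᵥ v) := by ring
    _ ≤ _ := by gcongr

/-- One sample's share of the second moment: `|a|²` and `|b|²` are each at most `V q`, which cancels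
the remaining `q⁻¹`. Summed over rows, the right side becomes `V (|Au|² + |Bv|²)`. -/
lemma mul_dotProduct_dilation_mulVec_le {k l : Type*} [Fintype k] [Fintype l]
    (a u : k → ℝ) (b v : l → ℝ) {q V : ℝ} (hq : 0 ≤ q) (hV : 0 ≤ V)
    (h : a ⬝ᵥ a + b ⬝ᵥ b ≤ V * q) :
    q * ((dilation (q⁻¹ • Matrix.vecMulVec a b) *ᵥ Sum.elim u v) ⬝ᵥ
      (dilation (q⁻¹ • Matrix.vecMulVec a b) *ᵥ Sum.elim u v)) ≤
    V * ((a ⬝ᵥ u) ^ 2 + (b ⬝ᵥ v) ^ 2) := by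
  rw [dotProduct_dilation_vecMulVec_mulVec]
  have ha : 0 ≤ a ⬝ᵥ a := by simpa using dotProduct_star_self_nonneg a
  have hb : 0 ≤ b ⬝ᵥ b := by simpa using dotProduct_star_self_nonneg b
  rcases hq.eq_or_lt with rfl | hq
  · simp; positivity
  · have h1 : q * (q⁻¹ ^ 2 * ((b ⬝ᵥ v) ^ 2 * (a ⬝ᵥ a) + (a ⬝ᵥ u) ^ 2 * (b ⬝ᵥ b))) =
        q⁻¹ * ((b ⬝ᵥ v) ^ 2 * (a ⬝ᵥ a) + (a ⬝ᵥ u) ^ 2 * (b ⬝ᵥ b)) := by field_simp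
    rw [h1, inv_mul_le_iff₀ hq]
    nlinarith [mul_le_mul_of_nonneg_left (show a ⬝ᵥ a ≤ V * q by linarith) (sq_nonneg (b ⬝ᵥ v)),
      mul_le_mul_of_nonneg_left (show b ⬝ᵥ b ≤ V * q by linarith) (sq_nonneg (a ⬝ᵥ u))]

end Dilation

/-! ### Tail bound for row sampling, and its translation to random indices. -/

section Sampling

variable {m d₁ d₂ r : ℕ}

lemma transpose_mul_eq_sum_vecMulVec (A : Matrix (Fin m) (Fin d₁) ℝ)
    (B : Matrix (Fin m) (Fin d₂) ℝ) : Aᵀ * B = ∑ t, Matrix.vecMulVec (A t) (B t) := by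
  ext i j
  simp [Matrix.mul_apply, Matrix.sum_apply, Matrix.vecMulVec_apply]

/-- Tail bound for the row-sampling estimate of `Aᵀ * B` when `‖A‖, ‖B‖ ≤ 1`. -/
lemma sum_prod_norm_sub_gt_le {A : Matrix (Fin m) (Fin d₁) ℝ} {B : Matrix (Fin m) (Fin d₂) ℝ}
    [Nonempty (Fin d₁ ⊕ Fin d₂)] (hA : ‖A‖ ≤ 1) (hB : ‖B‖ ≤ 1) {p : Fin m → ℝ}
    (hp : ∀ t, 0 ≤ p t) (hp1 : ∑ t, p t = 1) {V ε : ℝ} (hV : 0 < V) (hε : 0 < ε) (hε1 : ε ≤ 1)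
    (hw : ∀ t, A t ⬝ᵥ A t + B t ⬝ᵥ B t ≤ V * p t) (hr : 0 < r) (F : Finset (Fin r → Fin m))
    (hF : ∀ f ∈ F, ε ≤ ‖Aᵀ * B
      - (r : ℝ)⁻¹ • ∑ j, (p (f j))⁻¹ • Matrix.vecMulVec (A (f j)) (B (f j))‖) :
    ∑ f ∈ F, ∏ j, p (f j) ≤ 2 * ((d₁ : ℝ) + d₂) * Real.exp (-(r * ε ^ 2 / (4 * V))) := by
  set Y : Fin m → Matrix (Fin d₁) (Fin d₂) ℝ :=
    fun t => (p t)⁻¹ • Matrix.vecMulVec (A t) (B t) with hY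
  have hr0 : (0 : ℝ) < r := by exact_mod_cast hr
  -- An index with `p t = 0` loses nothing: `hw` forces its rows to vanish.
  have hpY : ∀ t, p t • Y t = Matrix.vecMulVec (A t) (B t) := fun t => by
    rcases (hp t).eq_or_lt with h0 | h0
    · have h1 := hw t
      rw [← h0, mul_zero] at h1
      have ha : 0 ≤ A t ⬝ᵥ A t := by simpa using dotProduct_star_self_nonneg (A t)
      have hb : 0 ≤ B t ⬝ᵥ B t := by simpa using dotProduct_star_self_nonneg (B t)
      have h2 : A t = 0 := dotProduct_self_eq_zero.1 (by linarith)
      rw [← h0, zero_smul, h2, Matrix.zero_vecMulVec]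
    · rw [hY, smul_smul, mul_inv_cancel₀ h0.ne', one_smul]
  have hmean : ∑ t, p t • dilation (Y t) = dilation (Aᵀ * B) := by
    rw [transpose_mul_eq_sum_vecMulVec, map_sum]
    exact Finset.sum_congr rfl fun t _ => by rw [← map_smul, hpY]
  have hDY : ∀ t, ‖dilation (Y t)‖ ≤ V / 2 := fun t =>
    norm_dilation_smul_vecMulVec_le _ _ (hp t) hV.le (hw t)
  have hDM : ‖dilation (Aᵀ * B)‖ ≤ V / 2 := by
    rw [← hmean]
    refine (norm_sum_le _ _).trans ?_
    calc _ ≤ ∑ t, p t * (V / 2) := Finset.sum_le_sum fun t _ => by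
          rw [norm_smul, Real.norm_of_nonneg (hp t)]
          exact mul_le_mul_of_nonneg_left (hDY t) (hp t)
      _ = V / 2 := by rw [← Finset.sum_mul, hp1, one_mul]
  have hvar : (V • (1 : Matrix (Fin d₁ ⊕ Fin d₂) (Fin d₁ ⊕ Fin d₂) ℝ)
      - ∑ t, p t • dilation (Y t) ^ 2).PosSemidef := by
    refine Matrix.PosSemidef.of_dotProduct_mulVec_nonneg ?_ fun x => ?_
    · rw [Matrix.IsHermitian, Matrix.conjTranspose_eq_transpose_of_trivial]
      simp [Matrix.transpose_sum, (dilation_isSymm _).eq]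
    · obtain ⟨u, v, rfl⟩ : ∃ u v, x = Sum.elim u v := ⟨_, _, (Sum.elim_comp_inl_inr x).symm⟩
      have hsq : ∀ t, Sum.elim u v ⬝ᵥ (dilation (Y t) ^ 2 *ᵥ Sum.elim u v) =
          (dilation (Y t) *ᵥ Sum.elim u v) ⬝ᵥ (dilation (Y t) *ᵥ Sum.elim u v) := fun t => by
        rw [pow_two, ← Matrix.mulVec_mulVec, Matrix.dotProduct_mulVec, ← Matrix.mulVec_transpose,
          (dilation_isSymm _).eq]
      have hsum : ∑ t, p t * ((dilation (Y t) *ᵥ Sum.elim u v) ⬝ᵥ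
          (dilation (Y t) *ᵥ Sum.elim u v)) ≤ V * (u ⬝ᵥ u + v ⬝ᵥ v) := by
        calc _ ≤ ∑ t, V * ((A t ⬝ᵥ u) ^ 2 + (B t ⬝ᵥ v) ^ 2) := Finset.sum_le_sum fun t _ =>
              mul_dotProduct_dilation_mulVec_le _ _ _ _ (hp t) hV.le (hw t)
          _ = V * ((A *ᵥ u) ⬝ᵥ (A *ᵥ u) + (B *ᵥ v) ⬝ᵥ (B *ᵥ v)) := by
              rw [← Finset.mul_sum, Finset.sum_add_distrib]
              simp only [pow_two]
              rfl
          _ ≤ _ := by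
              have hu : 0 ≤ u ⬝ᵥ u := by simpa using dotProduct_star_self_nonneg u
              have hv : 0 ≤ v ⬝ᵥ v := by simpa using dotProduct_star_self_nonneg v
              gcongr
              · exact (dotProduct_mulVec_self_le A u).trans
                  (mul_le_of_le_one_left hu (pow_le_one₀ (norm_nonneg _) hA))
              · exact (dotProduct_mulVec_self_le B v).trans
                  (mul_le_of_le_one_left hv (pow_le_one₀ (norm_nonneg _) hB))
      rw [star_trivial, Matrix.sub_mulVec, dotProduct_sub, Matrix.smul_mulVec, Matrix.one_mulVec,
        dotProduct_smul, dotProduct_elim_self, Matrix.sum_mulVec, dotProduct_sum]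
      simp only [Matrix.smul_mulVec, dotProduct_smul, hsq, smul_eq_mul]
      linarith
  -- This `η` minimizes the exponent `r (η ^ 2 V - η ε)`, with value `-r ε ^ 2 / (4 V)`; it also
  -- gives `η V = ε / 2 ≤ 1`, as the norm bound needs.
  set η := ε / (2 * V) with hη
  have hη0 : 0 < η := by positivity
  set X : Fin m → Matrix (Fin d₁ ⊕ Fin d₂) (Fin d₁ ⊕ Fin d₂) ℝ :=
    fun t => η • (dilation (Y t) - dilation (Aᵀ * B)) with hX
  have hXs : ∀ t, (X t).IsSymm := fun t => ((dilation_isSymm _).sub (dilation_isSymm _)).smul _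
  have hX1 : ∀ t, ‖X t‖ ≤ 1 := fun t => by
    rw [hX, norm_smul, Real.norm_of_nonneg hη0.le]
    calc _ ≤ η * (V / 2 + V / 2) := by
          gcongr
          exact (norm_sub_le _ _).trans (add_le_add (hDY t) hDM)
      _ = ε / 2 := by rw [hη]; field_simp; ring
      _ ≤ 1 := by linarith
  have hX0 : ∑ t, p t • X t = 0 := by
    simp only [hX, smul_comm _ η, ← Finset.smul_sum, smul_sub, Finset.sum_sub_distrib, hmean,
      ← Finset.sum_smul, hp1, one_smul, sub_self]
  -- Centering only lowers the second moment: the square of the mean is added to the gap in `hvar`.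
  have hXv : ((η ^ 2 * V) • (1 : Matrix (Fin d₁ ⊕ Fin d₂) (Fin d₁ ⊕ Fin d₂) ℝ)
      - ∑ t, p t • X t ^ 2).PosSemidef := by
    have h1 : (dilation (Aᵀ * B) ^ 2).PosSemidef := by
      have := Matrix.posSemidef_conjTranspose_mul_self (dilation (Aᵀ * B))
      rwa [Matrix.conjTranspose_eq_transpose_of_trivial, (dilation_isSymm _).eq, ← pow_two] at this
    convert (hvar.add h1).smul (sq_nonneg η) using 1
    have h2 : ∀ t, p t • X t ^ 2 = η ^ 2 • (p t • dilation (Y t) ^ 2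
        - (p t • dilation (Y t)) * dilation (Aᵀ * B) - dilation (Aᵀ * B) * (p t • dilation (Y t))
        + p t • dilation (Aᵀ * B) ^ 2) := fun t => by
      rw [hX, smul_pow, smul_comm]
      congr 1
      rw [smul_mul_assoc, mul_smul_comm, ← smul_sub, ← smul_sub, ← smul_add]
      congr 1
      noncomm_ring
    simp only [h2, ← Finset.smul_sum, Finset.sum_add_distrib, Finset.sum_sub_distrib,
      ← Finset.sum_mul, ← Finset.mul_sum, hmean, ← Finset.sum_smul, hp1, one_smul, mul_smul,
      ← smul_sub]
    congr 1
    noncomm_ring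
  have hs : ∀ f ∈ F, η * r * ε ≤ ‖∑ j, X (f j)‖ := fun f hf => by
    have h1 : ∑ j, X (f j) = -((η * r) • dilation (Aᵀ * B - (r : ℝ)⁻¹ • ∑ j, Y (f j))) := by
      simp only [hX, ← Finset.smul_sum, Finset.sum_sub_distrib, Finset.sum_const,
        Finset.card_univ, Fintype.card_fin, map_sub, map_smul, map_sum, mul_smul, smul_sub,
        smul_inv_smul₀ hr0.ne', Nat.cast_smul_eq_nsmul, neg_sub]
    rw [h1, norm_neg, norm_smul, Real.norm_of_nonneg (by positivity)]
    exact mul_le_mul_of_nonneg_left ((hF f hf).trans (norm_le_norm_dilation _)) (by positivity)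
  have h := sum_prod_norm_gt_le hp hp1 hXs hX1 hX0 hXv r (η * r * ε) F hs
  have hexp : r * (η ^ 2 * V) - η * r * ε = -(r * ε ^ 2 / (4 * V)) := by
    rw [hη]; field_simp; ring
  rw [hexp] at h
  simpa using h

variable {Ω : Type*} [MeasurableSpace Ω] {μ : Measure Ω} [IsProbabilityMeasure μ]

lemma IsIIDSample.measureReal_mem {p : Fin m → ℝ} {T : Fin r → Ω → Fin m}
    (hT : IsIIDSample μ p T) (S : Finset (Fin r → Fin m)) :
    μ.real {ω | (fun j => T j ω) ∈ S} = ∑ f ∈ S, ∏ j, p (f j) := by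
  have hmeas : Measurable fun ω j => T j ω := measurable_pi_lambda _ hT.measurable
  have hsing : ∀ f : Fin r → Fin m,
      (μ.map fun ω j => T j ω).real {f} = ∏ j, p (f j) := fun f => by
    rw [map_measureReal_apply hmeas (measurableSet_singleton f)]
    have h1 : (fun ω j => T j ω) ⁻¹' {f} = ⋂ j ∈ Finset.univ, T j ⁻¹' {f j} := by
      ext ω
      simp [funext_iff]
    rw [h1, measureReal_def, hT.indep.measure_inter_preimage_eq_mul Finset.univ
      (fun j _ => measurableSet_singleton (f j)), ENNReal.toReal_prod]
    exact Finset.prod_congr rfl fun j _ => hT.prob j (f j)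
  have h2 : {ω | (fun j => T j ω) ∈ S} = (fun ω j => T j ω) ⁻¹' (S : Set (Fin r → Fin m)) := rfl
  have : IsProbabilityMeasure (μ.map fun ω j => T j ω) :=
    Measure.isProbabilityMeasure_map hmeas.aemeasurable
  rw [h2, ← map_measureReal_apply hmeas S.measurableSet, ← sum_measureReal_singleton]
  exact Finset.sum_congr rfl fun f _ => hsing f

lemma samplingMatrix_mul_transpose_mul {p : Fin m → ℝ} (hp : ∀ t, 0 ≤ p t) (f : Fin r → Fin m)
    (A : Matrix (Fin m) (Fin d₁) ℝ) (B : Matrix (Fin m) (Fin d₂) ℝ) :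
    (samplingMatrix p f * A)ᵀ * (samplingMatrix p f * B) =
      (r : ℝ)⁻¹ • ∑ j, (p (f j))⁻¹ • Matrix.vecMulVec (A (f j)) (B (f j)) := by
  have hrow : ∀ {d : ℕ} (M : Matrix (Fin m) (Fin d) ℝ) (j : Fin r),
      (samplingMatrix p f * M) j = (1 / √((r : ℝ) * p (f j))) • M (f j) := fun M j => by
    ext i
    simp [samplingMatrix, Matrix.mul_apply, Pi.single_apply]
  rw [transpose_mul_eq_sum_vecMulVec, Finset.smul_sum]
  refine Finset.sum_congr rfl fun j _ => ?_
  rw [hrow, hrow]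
  ext i i'
  have h := Real.mul_self_sqrt (mul_nonneg (Nat.cast_nonneg r) (hp (f j)))
  simp only [Matrix.vecMulVec_apply, Pi.smul_apply, Matrix.smul_apply, smul_eq_mul]
  calc _ = (√((r : ℝ) * p (f j)) * √((r : ℝ) * p (f j)))⁻¹ * (A (f j) i * B (f j) i') := by
        rw [mul_inv]; ring
    _ = _ := by rw [h, mul_inv]; ring

lemma sum_rescaledRow_dotProduct_self {d : ℕ} (A : Matrix (Fin m) (Fin d) ℝ) :
    ∑ s, rescaledRow A s ⬝ᵥ rescaledRow A s = stableRank A := by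
  simp only [rescaledRow, stableRank, Matrix.row, dotProduct, Pi.smul_apply, smul_eq_mul]
  rw [Finset.sum_div]
  refine Finset.sum_congr rfl fun s _ => ?_
  rw [Finset.sum_div]
  refine Finset.sum_congr rfl fun j _ => ?_
  rw [div_eq_mul_inv, ← inv_pow]
  ring

lemma sum_rowWeight (A : Matrix (Fin m) (Fin d₁) ℝ) (B : Matrix (Fin m) (Fin d₂) ℝ) :
    ∑ s, rowWeight A B s = stableRank A + stableRank B := by
  simp only [rowWeight, Finset.sum_add_distrib, sum_rescaledRow_dotProduct_self]

lemma stableRank_pos {d : ℕ} {A : Matrix (Fin m) (Fin d) ℝ} (hA : A ≠ 0) : 0 < stableRank A := by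
  have hn : 0 < ‖A‖ := norm_pos_iff.2 hA
  obtain ⟨t, j, htj⟩ : ∃ t j, A t j ≠ 0 := by
    by_contra! h
    exact hA (Matrix.ext h)
  refine div_pos (Finset.sum_pos' (fun t _ => Finset.sum_nonneg fun j _ => sq_nonneg _)
    ⟨t, Finset.mem_univ t, Finset.sum_pos' (fun j _ => sq_nonneg _)
      ⟨j, Finset.mem_univ j, by positivity⟩⟩) (by positivity)

end Sampling

end RowSampling

/-! ### Normalization and choice of the sample size. -/

theorem mainTheorem3 {Ω : Type*} [MeasurableSpace Ω] (μ : Measure Ω) [IsProbabilityMeasure μ]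
    {m d₁ d₂ r : ℕ} (A : Matrix (Fin m) (Fin d₁) ℝ) (B : Matrix (Fin m) (Fin d₂) ℝ)
    (hA : A ≠ 0) (hB : B ≠ 0)
    (ε β δ : ℝ) (hε : 0 < ε) (hε1 : ε < 1) (hβ : 0 < β) (hβ1 : β ≤ 1) (hδ : 0 < δ)
    (p : Fin m → ℝ) (hp0 : ∀ t, 0 ≤ p t) (hp1 : ∑ t, p t = 1)
    (hp : ∀ t, β * (RowSampling.rowWeight A B t / ∑ s, RowSampling.rowWeight A B s) ≤ p t)
    (T : Fin r → Ω → Fin m) (hT : RowSampling.IsIIDSample μ p T)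
    (hr : 8 * (RowSampling.stableRank A + RowSampling.stableRank B) / (β * ε ^ 2)
      * Real.log (2 * ((d₁ : ℝ) + (d₂ : ℝ)) / δ) ≤ (r : ℝ)) :
    ∑ s, RowSampling.rowWeight A B s = RowSampling.stableRank A + RowSampling.stableRank B ∧
    1 - δ ≤ μ.real {ω |
      ‖Aᵀ * B
          - (RowSampling.samplingMatrix p (fun j => T j ω) * A)ᵀ
            * (RowSampling.samplingMatrix p (fun j => T j ω) * B)‖ ≤ ε * ‖A‖ * ‖B‖} := by
  refine ⟨RowSampling.sum_rowWeight A B, ?_⟩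
  rw [RowSampling.sum_rowWeight] at hp
  set ρ := RowSampling.stableRank A + RowSampling.stableRank B with hρ
  have hρ0 : 0 < ρ := add_pos (RowSampling.stableRank_pos hA) (RowSampling.stableRank_pos hB)
  have hnA : 0 < ‖A‖ := norm_pos_iff.2 hA
  have hnB : 0 < ‖B‖ := norm_pos_iff.2 hB
  have hd₁ : (1 : ℝ) ≤ d₁ := by
    rcases Nat.eq_zero_or_pos d₁ with rfl | h
    · exact absurd (Subsingleton.elim A 0) hA
    · exact_mod_cast h
  have hd₂ : (0 : ℝ) ≤ d₂ := Nat.cast_nonneg d₂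
  have hd0 : 0 < 2 * ((d₁ : ℝ) + d₂) := by linarith
  set V := ρ / β with hV
  have hV0 : 0 < V := div_pos hρ0 hβ
  have hlog : 8 * Real.log (2 * ((d₁ : ℝ) + d₂) / δ) ≤ r * ε ^ 2 / V := by
    rw [le_div_iff₀ hV0]
    have h := mul_le_mul_of_nonneg_right hr (sq_nonneg ε)
    calc _ = 8 * ρ / (β * ε ^ 2) * Real.log (2 * ((d₁ : ℝ) + d₂) / δ) * ε ^ 2 := by
          rw [hV]; field_simp
      _ ≤ _ := h
  have htail : 2 * ((d₁ : ℝ) + d₂) * Real.exp (-(r * ε ^ 2 / (4 * V))) ≤ δ := by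
    -- Only the constant 4 is needed. The logarithm may be negative, so relaxing 8 to 4 uses `h3`.
    have h1 : Real.log (2 * ((d₁ : ℝ) + d₂) / δ) ≤ r * ε ^ 2 / (4 * V) := by
      have h2 : r * ε ^ 2 / (4 * V) = r * ε ^ 2 / V / 4 := by field_simp
      have h3 : 0 ≤ r * ε ^ 2 / V := by positivity
      rw [h2]
      linarith
    rw [Real.log_le_iff_le_exp (by positivity), div_le_iff₀ hδ] at h1
    rw [Real.exp_neg, ← div_eq_mul_inv, div_le_iff₀ (Real.exp_pos _)]
    linarith
  -- With no samples the exponential in `htail` is 1, forcing `δ ≥ 1`, and the claim is trivial.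
  rcases Nat.eq_zero_or_pos r with rfl | hr0
  · have h1 : 1 ≤ δ := by
      simp only [Nat.cast_zero, zero_mul, zero_div, neg_zero, Real.exp_zero, mul_one] at htail
      linarith
    linarith [measureReal_nonneg (μ := μ) (s := {ω |
      ‖Aᵀ * B - (RowSampling.samplingMatrix p (fun j => T j ω) * A)ᵀ
        * (RowSampling.samplingMatrix p (fun j => T j ω) * B)‖ ≤ ε * ‖A‖ * ‖B‖})]
  classical
  set G : Finset (Fin r → Fin m) := Finset.univ.filter fun f =>
    ‖Aᵀ * B - (RowSampling.samplingMatrix p f * A)ᵀ * (RowSampling.samplingMatrix p f * B)‖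
      ≤ ε * ‖A‖ * ‖B‖ with hG
  have hset : {ω | ‖Aᵀ * B - (RowSampling.samplingMatrix p (fun j => T j ω) * A)ᵀ
      * (RowSampling.samplingMatrix p (fun j => T j ω) * B)‖ ≤ ε * ‖A‖ * ‖B‖} =
      {ω | (fun j => T j ω) ∈ G} := by
    ext ω
    simp [hG]
  have htotal : ∑ f ∈ G, ∏ j, p (f j) + ∑ f ∈ Gᶜ, ∏ j, p (f j) = 1 := by
    rw [Finset.sum_add_sum_compl, ← hT.measureReal_mem]
    · simp
  have hinst : Nonempty (Fin d₁ ⊕ Fin d₂) :=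
    ⟨Sum.inl ⟨0, by exact_mod_cast (zero_lt_one.trans_le hd₁)⟩⟩
  have hbad : ∑ f ∈ Gᶜ, ∏ j, p (f j)
      ≤ 2 * ((d₁ : ℝ) + d₂) * Real.exp (-(r * ε ^ 2 / (4 * V))) := by
    refine RowSampling.sum_prod_norm_sub_gt_le (A := ‖A‖⁻¹ • A) (B := ‖B‖⁻¹ • B) ?_ ?_ hp0 hp1
      hV0 hε hε1.le (fun t => ?_) hr0 _ fun f hf => ?_
    · rw [norm_smul, norm_inv, norm_norm, inv_mul_cancel₀ hnA.ne']
    · rw [norm_smul, norm_inv, norm_norm, inv_mul_cancel₀ hnB.ne']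
    · have h := hp t
      rw [← mul_div_assoc, div_le_iff₀ hρ0] at h
      rw [hV, div_mul_eq_mul_div, le_div_iff₀ hβ]
      change RowSampling.rowWeight A B t * β ≤ ρ * p t
      linarith
    · have h : ε * ‖A‖ * ‖B‖ < ‖Aᵀ * B - (RowSampling.samplingMatrix p f * A)ᵀ
          * (RowSampling.samplingMatrix p f * B)‖ := by
        simpa [hG] using hf
      have h1 : (‖A‖⁻¹ • A)ᵀ * (‖B‖⁻¹ • B) - (r : ℝ)⁻¹ • ∑ j, (p (f j))⁻¹ •
          Matrix.vecMulVec ((‖A‖⁻¹ • A) (f j)) ((‖B‖⁻¹ • B) (f j)) =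
          (‖A‖⁻¹ * ‖B‖⁻¹) • (Aᵀ * B - (RowSampling.samplingMatrix p f * A)ᵀ
            * (RowSampling.samplingMatrix p f * B)) := by
        rw [← RowSampling.samplingMatrix_mul_transpose_mul hp0]
        simp only [Matrix.mul_smul, Matrix.smul_mul, Matrix.transpose_smul, smul_sub, smul_smul,
          mul_comm ‖A‖⁻¹]
      rw [h1, norm_smul, Real.norm_of_nonneg (by positivity), ← mul_inv,
        inv_mul_eq_div, le_div_iff₀ (by positivity)]
      linarith
  rw [hset, hT.measureReal_mem]
  linarith
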